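/- Let $G$ be a finite group and let $M, N$ be normal subgroups of $G$ with $1 \neq M < N$. Write $\mathrm{Irr}(G)$ for the set of irreducible complex characters of $G$, $\ker\chi = \{g \in G : \chi(g) = \chi(1)\}$ for the kernel of a character $\chi$, $\mathrm{Irr}(G\mid M) = \{\chi \in \mathrm{Irr}(G) : M \not\leq \ker\chi\}$, and $$V(G\mid M) = \langle\, g \in G : \chi(g) \neq 0 \text{ for some } \chi \in \mathrm{Irr}(G\mid M) \,\rangle .$$ For normal subgroups $1 \neq M \leq N$ of $G$, call $(G,N,M)$ a Camina triple if every $g \in G \setminus N$ is conjugate in $G$ to every element of the coset $gM$. Let $[g,y] = g^{-1}y^{-1}gy$. Then the following are equivalent: 1. $(G,N,M)$ is a Camina triple. 2. $|C_G(g)| = |C_{G/M}(Mg)|$ for every $g \in G\setminus N$. 3. For every $g \in G \setminus N$, $\chi(g) = 0$ for all $\chi \in \mathrm{Irr}(G\mid M)$. 4. $V(G\mid M) \leq N$. 5. For all $g \in G\setminus N$ and all $z \in M$ there exists $y \in G$ such that $[g,y] = z$. -/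

import Mathlib

namespace Camina

/-- The set `Irr(G)` of irreducible complex characters of `G`, as functions `G → ℂ`: the characters
of the irreducible representations of `G` on the spaces `ℂⁿ`. -/
def Irr (G : Type*) [Group G] : Set (G → ℂ) :=
  {χ | ∃ (n : ℕ) (ρ : Representation ℂ G (Fin n → ℂ)), ρ.IsIrreducible ∧ χ = ρ.character}

/-- The kernel of a character `χ`: the elements `g` with `χ(g) = χ(1)`. -/
def charKer {G : Type*} [Group G] (χ : G → ℂ) : Set G :=
  {g | χ g = χ 1}

/-- `Irr(G|M)`: the irreducible characters of `G` whose kernel does not contain `M`. -/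
def IrrOver (G : Type*) [Group G] (M : Subgroup G) : Set (G → ℂ) :=
  {χ | χ ∈ Irr G ∧ ¬ (M : Set G) ⊆ charKer χ}

/-- The vanishing-off subgroup `V(G|M)`: the subgroup generated by the elements of `G` at which
some character in `Irr(G|M)` does not vanish. -/
def vanishingOff (G : Type*) [Group G] (M : Subgroup G) : Subgroup G :=
  Subgroup.closure {g | ∃ χ ∈ IrrOver G M, χ g ≠ 0}

/-- `(G, N, M)` is a Camina triple: `1 < M ≤ N` are normal subgroups of `G`, and every `g` outside
`N` is conjugate in `G` to every element of the coset `gM`. -/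
structure IsCaminaTriple (G : Type*) [Group G] (N M : Subgroup G) : Prop where
  normal_left : N.Normal
  normal_right : M.Normal
  ne_bot : M ≠ ⊥
  le : M ≤ N
  isConj : ∀ g : G, g ∉ N → ∀ m ∈ M, IsConj g (g * m)

end Camina

/-! Fix `g` outside `N`. The preimage in `G` of the class of `gM` contains the class of `g`, and
orbit-stabilizer in `G` and `G ⧸ M` turns equality of centralizer orders into equality of these
sets, that is, `gM` lies in the class of `g`.

For characters, `M` acts trivially in an irreducible representation or the sum of its elements acts
as zero (`trivial_or_sum_eq_zero`). Hence a character in `Irr(G|M)` sums to zero over `gM`, so it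
vanishes at `g` if `gM` lies in one class. Conversely, all other irreducible characters are constant
on `gM`; if those in `Irr(G|M)` vanish off `N`, no irreducible character separates `g` from `gm`,
and `isConj_of_forall_Irr` makes them conjugate.

The commutator condition is a rewording, as `g[g,y] = y⁻¹gy`. -/

namespace Camina

open scoped MonoidAlgebra

/-! ### Irreducible representations and Schur's lemma. -/

section Irreducible

variable {G : Type*} [Group G] {V : Type*} [AddCommGroup V] [Module ℂ V]

/-- The vectors fixed by a normal subgroup form a subrepresentation. -/
def fixedSubrepresentation (ρ : Representation ℂ G V) (M : Subgroup G) [M.Normal] :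
    Subrepresentation ρ where
  toSubmodule :=
    { carrier := {v | ∀ m ∈ M, ρ m v = v}
      add_mem' := fun ha hb m hm => by rw [map_add, ha m hm, hb m hm]
      zero_mem' := fun m _ => map_zero _
      smul_mem' := fun c v hv m hm => by rw [map_smul, hv m hm] }
  apply_mem_toSubmodule g v hv m hm := by
    have h := hv (g⁻¹ * m * g) (by simpa using ‹M.Normal›.conj_mem m hm g⁻¹)
    calc ρ m (ρ g v) = ρ g (ρ (g⁻¹ * m * g) v) := by
          simp only [← Module.End.mul_apply, ← map_mul]
          congr 2
          group
      _ = ρ g v := by rw [h]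

theorem mem_fixedSubrepresentation {ρ : Representation ℂ G V} {M : Subgroup G} [M.Normal] {v : V} :
    v ∈ fixedSubrepresentation ρ M ↔ ∀ m ∈ M, ρ m v = v := Iff.rfl

/-- A normal subgroup either acts trivially in an irreducible representation, or the sum of its
elements acts as zero. -/
theorem trivial_or_sum_eq_zero (ρ : Representation ℂ G V) [ρ.IsIrreducible] (M : Subgroup G)
    [M.Normal] [Fintype M] : (∀ m ∈ M, ρ m = 1) ∨ ∑ m : M, ρ m = 0 := by
  rcases eq_bot_or_eq_top (fixedSubrepresentation ρ M) with h | h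
  · right
    ext v
    have hv : (∑ m : M, ρ m) v ∈ fixedSubrepresentation ρ M := by
      intro m hm
      simp only [LinearMap.sum_apply, map_sum, ← Module.End.mul_apply, ← map_mul]
      exact Fintype.sum_equiv (Equiv.mulLeft (⟨m, hm⟩ : M)) _ _ fun x => rfl
    rw [h] at hv
    exact hv
  · left
    intro m hm
    ext v
    have hv : v ∈ fixedSubrepresentation ρ M := by
      rw [h]
      exact Submodule.mem_top (R := ℂ)
    exact hv m hm

theorem finrank_ne_zero_of_isIrreducible [FiniteDimensional ℂ V] (ρ : Representation ℂ G V)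
    [ρ.IsIrreducible] : (Module.finrank ℂ V : ℂ) ≠ 0 := by
  rw [Nat.cast_ne_zero]
  intro h
  have := Module.finrank_zero_iff.mp h
  apply bot_ne_top (α := Subrepresentation ρ)
  ext v
  rw [Subsingleton.elim v 0]
  exact ⟨fun _ => Submodule.zero_mem _, fun _ => Submodule.zero_mem _⟩

/-- An endomorphism of trace zero commuting with an irreducible representation is zero. -/
theorem eq_zero_of_commute_of_trace_eq_zero [FiniteDimensional ℂ V] (ρ : Representation ℂ G V)
    [ρ.IsIrreducible] (T : V →ₗ[ℂ] V) (hT : ∀ g, T ∘ₗ ρ g = ρ g ∘ₗ T)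
    (htr : LinearMap.trace ℂ V T = 0) : T = 0 := by
  obtain ⟨c, hc⟩ :=
    (Representation.IsIrreducible.algebraMap_intertwiningMap_bijective_of_isAlgClosed
      (ρ := ρ)).2 ⟨T, hT⟩
  have hTc : T = c • LinearMap.id := by
    ext v
    exact (DFunLike.congr_fun hc v).symm
  rw [hTc, map_smul, LinearMap.trace_id, smul_eq_mul] at htr
  rw [hTc, (mul_eq_zero.mp htr).resolve_right (finrank_ne_zero_of_isIrreducible ρ), zero_smul]

/-- The character of an irreducible finite-dimensional representation belongs to `Irr G`. -/
theorem character_mem_Irr [FiniteDimensional ℂ V] (ρ : Representation ℂ G V) [ρ.IsIrreducible] :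
    ρ.character ∈ Irr G := by
  let e : V ≃ₗ[ℂ] (Fin (Module.finrank ℂ V) → ℂ) := (Module.finBasis ℂ V).equivFun
  let σ : Representation ℂ G (Fin (Module.finrank ℂ V) → ℂ) :=
    (e.conjRingEquiv : Module.End ℂ V →* Module.End ℂ (Fin (Module.finrank ℂ V) → ℂ)).comp ρ
  have hσ : ∀ g v, σ g (e v) = e (ρ g v) := fun g v => by
    change e (ρ g (e.symm (e v))) = _
    rw [e.symm_apply_apply]
  let φ : ρ.Equiv σ := .mk e fun g => LinearMap.ext fun v => (hσ g v).symm
  have hσirr : σ.IsIrreducible := by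
    let o : Subrepresentation σ ≃o Subrepresentation ρ :=
      { toFun := fun W => ⟨W.toSubmodule.comap e.toLinearMap, fun g v hv => by
          have := W.apply_mem_toSubmodule g hv
          simpa [hσ] using this⟩
        invFun := fun W => ⟨W.toSubmodule.comap e.symm.toLinearMap, fun g v hv => by
          have h1 := W.apply_mem_toSubmodule g hv
          have h2 : e.symm (σ g v) = ρ g (e.symm v) := by
            rw [LinearEquiv.symm_apply_eq, ← hσ, e.apply_symm_apply]
          change e.symm (σ g v) ∈ W.toSubmodule
          rw [h2]
          exact h1⟩
        left_inv := fun W => by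
          ext v
          change e (e.symm v) ∈ W ↔ _
          rw [e.apply_symm_apply]
          rfl
        right_inv := fun W => by
          ext v
          change e.symm (e v) ∈ W ↔ _
          rw [e.symm_apply_apply]
          rfl
        map_rel_iff' := by
          intro W W'
          refine ⟨fun h v hv => ?_, fun h v hv => h hv⟩
          have : e (e.symm v) ∈ W' := h (show e (e.symm v) ∈ W by rwa [e.apply_symm_apply])
          rwa [e.apply_symm_apply] at this }
    exact o.isSimpleOrder
  exact ⟨_, σ, hσirr, Representation.char_iso φ⟩

theorem asAlgebraHom_ofModule'_apply {S : Type*} [AddCommGroup S] [Module ℂ S] [Module ℂ[G] S]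
    [IsScalarTower ℂ ℂ[G] S] (r : ℂ[G]) (v : S) :
    (Representation.ofModule' (k := ℂ) (G := G) S).asAlgebraHom r v = r • v := by
  rw [Representation.asAlgebraHom_def, Representation.ofModule', Equiv.apply_symm_apply]
  rfl

/-- Makes Schur's lemma and `Irr G` available for the simple submodules of `ℂ[G]`. -/
theorem isIrreducible_ofModule' (S : Type*) [AddCommGroup S] [Module ℂ S] [Module ℂ[G] S]
    [IsScalarTower ℂ ℂ[G] S] [IsSimpleModule ℂ[G] S] :
    (Representation.ofModule' (k := ℂ) (G := G) S).IsIrreducible := by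
  rw [Representation.irreducible_iff_isSimpleModule_asModule]
  let ρ : Representation ℂ G S := Representation.ofModule' S
  let e : ρ.asModule ≃ₗ[ℂ[G]] S :=
    { ρ.asModuleEquiv.toAddEquiv with
      map_smul' := fun r v => (ρ.asModuleEquiv_map_smul r v).trans
        (asAlgebraHom_ofModule'_apply r (ρ.asModuleEquiv v)) }
  exact IsSimpleModule.congr e

end Irreducible

/-! ### Irreducible characters separate conjugacy classes. -/

section Separation

variable {G : Type*} [Group G] [Fintype G]

/-- The sum of all conjugates of `g`, counted with multiplicity, in the group algebra. -/
noncomputable def conjSum (g : G) : ℂ[G] :=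
  ∑ t : G, MonoidAlgebra.single (t * g * t⁻¹) 1

variable {V : Type*} [AddCommGroup V] [Module ℂ V]

theorem asAlgebraHom_conjSum (ρ : Representation ℂ G V) (g : G) :
    ρ.asAlgebraHom (conjSum g) = ∑ t : G, ρ (t * g * t⁻¹) := by
  simp [conjSum]

theorem asAlgebraHom_conjSum_comm (ρ : Representation ℂ G V) (g x : G) :
    ρ.asAlgebraHom (conjSum g) ∘ₗ ρ x = ρ x ∘ₗ ρ.asAlgebraHom (conjSum g) := by
  rw [asAlgebraHom_conjSum]
  change (∑ t : G, ρ (t * g * t⁻¹)) * ρ x = ρ x * ∑ t : G, ρ (t * g * t⁻¹)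
  rw [Finset.sum_mul, Finset.mul_sum]
  refine Fintype.sum_equiv (Equiv.mulLeft x⁻¹) _ _ fun t => ?_
  rw [← map_mul, ← map_mul]
  congr 1
  simp only [Equiv.coe_mulLeft]
  group

theorem trace_asAlgebraHom_conjSum [FiniteDimensional ℂ V] (ρ : Representation ℂ G V) (g : G) :
    LinearMap.trace ℂ V (ρ.asAlgebraHom (conjSum g)) = Fintype.card G * ρ.character g := by
  rw [asAlgebraHom_conjSum, map_sum]
  simp_rw [show ∀ x, LinearMap.trace ℂ V (ρ x) = ρ.character x from fun _ => rfl,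
    Representation.char_conj]
  simp

/-- Elements on which all irreducible characters agree have equal conjugate sums. -/
theorem conjSum_eq_of_forall_Irr {g h : G} (hgh : ∀ χ ∈ Irr G, χ g = χ h) :
    conjSum g = conjSum h := by
  -- By Maschke, `ℂ[G]` is the sum of its simple submodules. On each, the difference commutes with
  -- `G` and has trace `|G| (χ g - χ h) = 0`, so it acts as zero.
  have key : conjSum g - conjSum h ∈ Module.annihilator ℂ[G] ℂ[G] := by
    rw [← Submodule.annihilator_top, ← IsSemisimpleModule.sSup_simples_eq_top, sSup_eq_iSup',
      Submodule.annihilator_iSup, Submodule.mem_iInf]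
    rintro ⟨S, hS⟩
    have hS' : IsSimpleModule ℂ[G] S := hS
    let ρ : Representation ℂ G S := Representation.ofModule' S
    have : ρ.IsIrreducible := isIrreducible_ofModule' S
    have : Module.Finite ℂ ℂ[G] :=
      Module.Finite.equiv (MonoidAlgebra.coeffLinearEquiv (M := G) (S := ℂ) ℂ).symm
    have : Module.Finite ℂ S := inferInstanceAs (Module.Finite ℂ (S.restrictScalars ℂ))
    have hz : ρ.asAlgebraHom (conjSum g - conjSum h) = 0 := by
      refine eq_zero_of_commute_of_trace_eq_zero ρ _ (fun x => ?_) ?_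
      · rw [map_sub, LinearMap.sub_comp, LinearMap.comp_sub, asAlgebraHom_conjSum_comm,
          asAlgebraHom_conjSum_comm]
      · rw [map_sub, map_sub, trace_asAlgebraHom_conjSum, trace_asAlgebraHom_conjSum,
          hgh _ (character_mem_Irr ρ), sub_self]
    rw [Submodule.mem_annihilator]
    intro s hs
    have h2 := LinearMap.congr_fun hz ⟨s, hs⟩
    rw [asAlgebraHom_ofModule'_apply] at h2
    exact congrArg Subtype.val h2
  have h1 := Module.mem_annihilator.mp key 1
  rwa [smul_eq_mul, mul_one, sub_eq_zero] at h1

/-- Irreducible characters separate conjugacy classes. -/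
theorem isConj_of_forall_Irr {g h : G} (hgh : ∀ χ ∈ Irr G, χ g = χ h) : IsConj g h := by
  classical
  by_contra hne
  -- The coefficient at `h` counts the `t` that conjugate the given element to `h`: none for `g`,
  -- but at least `t = 1` for `h`.
  have h1 := congrArg (fun a : ℂ[G] => a.coeff h) (conjSum_eq_of_forall_Irr hgh)
  simp only [conjSum, MonoidAlgebra.coeff_sum, MonoidAlgebra.coeff_single,
    Finsupp.finsetSum_apply, Finsupp.single_apply] at h1
  rw [Finset.sum_eq_zero fun t _ => if_neg fun ht => hne (isConj_iff.mpr ⟨t, ht⟩),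
    Finset.sum_boole, eq_comm, Nat.cast_eq_zero, Finset.card_eq_zero] at h1
  exact Finset.notMem_empty (1 : G) (h1 ▸ by simp)

end Separation

/-! ### Characters on cosets of `M`, and centralizer orders. -/

section Camina

variable {G : Type*} [Group G]

theorem Irr.apply_eq_of_isConj {χ : G → ℂ} (hχ : χ ∈ Irr G) {g h : G} (hgh : IsConj g h) :
    χ g = χ h := by
  obtain ⟨n, ρ, -, rfl⟩ := hχ
  obtain ⟨c, rfl⟩ := isConj_iff.mp hgh
  exact (ρ.char_conj g c).symm

/-- A character of `Irr(G|M)` sums to zero over each coset of `M`. -/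
theorem IrrOver.sum_coset_eq_zero {M : Subgroup G} [M.Normal] [Fintype M] {χ : G → ℂ}
    (hχ : χ ∈ IrrOver G M) (g : G) : ∑ m : M, χ (g * m) = 0 := by
  obtain ⟨⟨n, ρ, hρ, rfl⟩, hM⟩ := hχ
  rcases trivial_or_sum_eq_zero ρ M with h | h
  · exact absurd (fun m hm => by simp [charKer, Representation.character, h m hm]) hM
  · have : ∑ m : M, ρ (g * m) = 0 := by simp_rw [map_mul, ← Finset.mul_sum, h, mul_zero]
    simp_rw [Representation.character, ← map_sum, this, map_zero]

/-- A character of `Irr(G)` whose kernel contains `M` is constant on the cosets of `M`. -/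
theorem Irr.apply_mul_eq_of_subset_charKer {M : Subgroup G} [M.Normal] [Finite M] {χ : G → ℂ}
    (hχ : χ ∈ Irr G) (hM : (M : Set G) ⊆ charKer χ) (g : G) {m : G} (hm : m ∈ M) :
    χ (g * m) = χ g := by
  have := Fintype.ofFinite M
  obtain ⟨n, ρ, hρ, rfl⟩ := hχ
  rcases trivial_or_sum_eq_zero ρ M with h | h
  · simp [Representation.character, h m hm]
  -- Here `χ` equals `χ 1` throughout `M`, so a zero sum would give `|M| χ(1) = 0`.
  · have h1 : ∑ m : M, ρ.character m = 0 := by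
      simp_rw [Representation.character, ← map_sum, h, map_zero]
    rw [Finset.sum_congr rfl fun (m : M) _ => show ρ.character m = ρ.character 1 from hM m.2,
      Finset.sum_const, Finset.card_univ, nsmul_eq_mul, Representation.char_one] at h1
    exact absurd h1
      (mul_ne_zero (Nat.cast_ne_zero.mpr Fintype.card_ne_zero) (finrank_ne_zero_of_isIrreducible ρ))

theorem card_carrier_mul_card_centralizer (g : G) :
    Nat.card (ConjClasses.mk g).carrier * Nat.card (Subgroup.centralizer {g}) = Nat.card G := by
  rw [← ConjAct.orbit_eq_carrier_conjClasses, Subgroup.nat_card_centralizer_nat_card_stabilizer,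
    ← Nat.card_prod, Nat.card_congr (MulAction.orbitProdStabilizerEquivGroup (ConjAct G) g)]
  rfl

variable (M : Subgroup G) [M.Normal]

theorem carrier_subset_preimage (g : G) :
    (ConjClasses.mk g).carrier ⊆
      QuotientGroup.mk ⁻¹' (ConjClasses.mk (g : G ⧸ M)).carrier := by
  intro x hx
  rw [ConjClasses.mem_carrier_iff_mk_eq, ConjClasses.mk_eq_mk_iff_isConj] at hx
  rw [Set.mem_preimage, ConjClasses.mem_carrier_iff_mk_eq, ConjClasses.mk_eq_mk_iff_isConj]
  exact (QuotientGroup.mk' M).map_isConj hx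

/-- The preimage consists of full cosets, so it is `|M|` times as large as the class in `G ⧸ M`. -/
theorem card_preimage_mul_card_centralizer (g : G) :
    Nat.card (QuotientGroup.mk ⁻¹' (ConjClasses.mk (g : G ⧸ M)).carrier : Set G) *
      Nat.card (Subgroup.centralizer {(g : G ⧸ M)}) = Nat.card G := by
  rw [Nat.card_congr (QuotientGroup.preimageMkEquivSubgroupProdSet M _), Nat.card_prod, mul_assoc,
    card_carrier_mul_card_centralizer, mul_comm, ← Subgroup.card_eq_card_quotient_mul_card_subgroup]

theorem card_centralizer_eq_iff [Finite G] (g : G) :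
    Nat.card (Subgroup.centralizer {g}) = Nat.card (Subgroup.centralizer {(g : G ⧸ M)}) ↔
      (ConjClasses.mk g).carrier =
        QuotientGroup.mk ⁻¹' (ConjClasses.mk (g : G ⧸ M)).carrier := by
  have h1 := card_carrier_mul_card_centralizer g
  have h2 := card_preimage_mul_card_centralizer M g
  constructor
  · intro h
    refine Set.eq_of_subset_of_ncard_le (carrier_subset_preimage M g) (le_of_eq ?_)
      (Set.toFinite _)
    rw [h, ← h2] at h1
    exact (Nat.eq_of_mul_eq_mul_right Nat.card_pos h1).symm
  · intro h
    rw [← h, ← h1] at h2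
    have : Nonempty (ConjClasses.mk g).carrier := ⟨g, ConjClasses.mem_carrier_mk⟩
    exact (Nat.eq_of_mul_eq_mul_left Nat.card_pos h2).symm

/-- The preimage is the union of the conjugates of the coset `gM`. -/
theorem carrier_eq_preimage_iff (g : G) :
    (ConjClasses.mk g).carrier = QuotientGroup.mk ⁻¹' (ConjClasses.mk (g : G ⧸ M)).carrier ↔
      ∀ m ∈ M, IsConj g (g * m) := by
  constructor
  · intro h m hm
    have : g * m ∈ (ConjClasses.mk g).carrier := by
      rw [h, Set.mem_preimage, QuotientGroup.mk_mul_of_mem g hm]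
      exact ConjClasses.mem_carrier_mk
    rw [ConjClasses.mem_carrier_iff_mk_eq, ConjClasses.mk_eq_mk_iff_isConj] at this
    exact this.symm
  · intro h
    refine (carrier_subset_preimage M g).antisymm fun x hx => ?_
    rw [Set.mem_preimage, ConjClasses.mem_carrier_iff_mk_eq, ConjClasses.mk_eq_mk_iff_isConj,
      isConj_comm, isConj_iff] at hx
    obtain ⟨c, hc⟩ := hx
    obtain ⟨c, rfl⟩ := QuotientGroup.mk_surjective c
    have hm : (c * g * c⁻¹)⁻¹ * x ∈ M := QuotientGroup.eq.mp hc
    have hm' := ‹M.Normal›.conj_mem _ hm c⁻¹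
    rw [ConjClasses.mem_carrier_iff_mk_eq, ConjClasses.mk_eq_mk_iff_isConj, isConj_comm]
    refine (h _ hm').trans (isConj_iff.mpr ⟨c, ?_⟩)
    group

end Camina

end Camina

theorem mainTheorem3 {G : Type*} [Group G] [Finite G] (N M : Subgroup G) [N.Normal] [M.Normal]
    (hM : M ≠ ⊥) (hMN : M < N) :
    List.TFAE [
      Camina.IsCaminaTriple G N M,
      ∀ g : G, g ∉ N →
        Nat.card (Subgroup.centralizer {g}) = Nat.card (Subgroup.centralizer {(g : G ⧸ M)}),
      ∀ g : G, g ∉ N → ∀ χ ∈ Camina.IrrOver G M, χ g = 0,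
      Camina.vanishingOff G M ≤ N,
      ∀ g : G, g ∉ N → ∀ z ∈ M, ∃ y : G, g⁻¹ * y⁻¹ * g * y = z] := by
  have := Fintype.ofFinite G
  have := Fintype.ofFinite M
  tfae_have 1 ↔ 2 := by
    simp_rw [Camina.card_centralizer_eq_iff, Camina.carrier_eq_preimage_iff]
    exact ⟨fun h => h.isConj, fun h => ⟨‹_›, ‹_›, hM, hMN.le, h⟩⟩
  tfae_have 1 → 3 := by
    intro h g hg χ hχ
    have h1 := Camina.IrrOver.sum_coset_eq_zero hχ g
    rw [Finset.sum_congr rfl fun (m : M) _ =>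
        (Camina.Irr.apply_eq_of_isConj hχ.1 (h.isConj g hg m m.2)).symm,
      Finset.sum_const, smul_eq_zero] at h1
    exact h1.resolve_left Fintype.card_ne_zero
  tfae_have 3 → 1 := by
    refine fun h => ⟨‹_›, ‹_›, hM, hMN.le, fun g hg m hm => ?_⟩
    refine Camina.isConj_of_forall_Irr fun χ hχ => ?_
    by_cases hker : (M : Set G) ⊆ Camina.charKer χ
    · exact (Camina.Irr.apply_mul_eq_of_subset_charKer hχ hker g hm).symm
    · rw [h g hg χ ⟨hχ, hker⟩,
        h (g * m) (fun hgm => hg ((N.mul_mem_cancel_right (hMN.le hm)).mp hgm)) χ ⟨hχ, hker⟩]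
  tfae_have 3 ↔ 4 := by
    rw [Camina.vanishingOff, Subgroup.closure_le]
    constructor
    · rintro h g ⟨χ, hχ, hne⟩
      by_contra hg
      exact hne (h g hg χ hχ)
    · intro h g hg χ hχ
      by_contra hne
      exact hg (h ⟨χ, hχ, hne⟩)
  tfae_have 1 ↔ 5 := by
    constructor
    · intro h g hg z hz
      obtain ⟨c, hc⟩ := isConj_iff.mp (h.isConj g hg z hz)
      -- `isConj_iff` conjugates as `c g c⁻¹`, the commutator as `y⁻¹ g y`.
      refine ⟨c⁻¹, ?_⟩
      rw [inv_inv, mul_assoc, mul_assoc, inv_mul_eq_iff_eq_mul, ← mul_assoc, hc]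
    · refine fun h => ⟨‹_›, ‹_›, hM, hMN.le, fun g hg m hm => ?_⟩
      obtain ⟨y, rfl⟩ := h g hg m hm
      exact isConj_iff.mpr ⟨y⁻¹, by group⟩
  tfae_finish
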